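/- All graphs are finite, simple and undirected, and vertex weights are nonnegative real numbers. For $t>0$ and $g\ge 0$, a $(t,g)$-trimming of a vertex-weighted graph $G=(V,E)$ of total weight $W$ is a set $U\subseteq V$ of weight at most $W/t$ such that every simple path in $G$ of more than $g$ edges contains a vertex of $U$. A family of graphs is trimmable if for every real $t>0$ there is a $g\ge 0$, depending only on $t$, such that every graph of the family, with any nonnegative vertex weights, has a $(t,g)$-trimming. (i) Let $k\ge 0$, $d\ge 1$ and $t\ge 2$ be integers. Every vertex-weighted graph of treewidth at most $k$ and maximum degree at most $d$ has a $(t,\lceil K/2\rceil^{2t})$-trimming, where $K=(9k+7)d(d+1)-1$. (ii) Every family of graphs of bounded maximum degree and bounded treewidth is trimmable. -/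

import Mathlib

namespace SimpleGraph

/-- A tree decomposition `(T, B)` of a graph `G`. As `T` is a finite tree, taking its node set in
the lowest universe loses no generality. -/
structure TreeDecomposition {V : Type*} (G : SimpleGraph V) where
  /-- The nodes of the tree. -/
  X : Type
  [fintypeX : Fintype X]
  /-- The tree. -/
  T : SimpleGraph X
  isTree : T.IsTree
  /-- The bags. -/
  bag : X → Finset V
  /-- Every vertex of `G` lies in a bag and every edge of `G` has both ends in a common bag,
  i.e. the union of the subgraphs of `G` induced by the bags is `G`. -/
  exists_mem_bag : ∀ v, ∃ x, v ∈ bag x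
  exists_adj_mem_bag : ∀ u v, G.Adj u v → ∃ x, u ∈ bag x ∧ v ∈ bag x
  /-- If `y` is on the path from `x` to `z` in `T`, then `bag x ∩ bag z ⊆ bag y`. -/
  mem_bag_of_mem_path : ∀ (x z : X) (p : T.Walk x z), p.IsPath → ∀ y ∈ p.support,
    ∀ v, v ∈ bag x → v ∈ bag z → v ∈ bag y

attribute [instance] TreeDecomposition.fintypeX

/-- The width of a tree decomposition: the largest size of a bag, minus one. -/
def TreeDecomposition.width {V : Type*} {G : SimpleGraph V} (D : G.TreeDecomposition) : ℤ :=
  ((Finset.univ.sup fun x => (D.bag x).card : ℕ) : ℤ) - 1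

/-- The treewidth of a (finite) graph: the smallest width of a tree decomposition. (It is `-1`
for the graph without vertices.) -/
noncomputable def treewidth {V : Type*} (G : SimpleGraph V) : ℤ :=
  sInf {m : ℤ | ∃ D : G.TreeDecomposition, D.width = m}

/-- `U` is a `(t, g)`-trimming of the graph `G` with vertex weights `w`: its weight is at most
`W / t`, where `W` is the total weight, and it meets every simple path of more than `g` edges. -/
def IsTrimming {V : Type*} [Fintype V] (G : SimpleGraph V) (w : V → ℝ) (t : ℝ) (g : ℕ)
    (U : Finset V) : Prop :=
  ∑ v ∈ U, w v ≤ (∑ v, w v) / t ∧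
    ∀ (u v : V) (p : G.Walk u v), p.IsPath → g < p.length → ∃ x ∈ p.support, x ∈ U

/-- The graph `G` with vertex weights `w` is `(t, g)`-trimmable. -/
def IsTrimmable {V : Type*} [Fintype V] (G : SimpleGraph V) (w : V → ℝ) (t : ℝ) (g : ℕ) : Prop :=
  ∃ U : Finset V, G.IsTrimming w t g U

/-- A family of finite graphs is trimmable if for every real `t > 0` there is a `g`, depending only
on `t`, such that every graph in the family, with any nonnegative vertex weights, is
`(t, g)`-trimmable. -/
def IsTrimmableFamily {ι : Type*} {V : ι → Type*} [∀ i, Fintype (V i)]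
    (G : ∀ i, SimpleGraph (V i)) : Prop :=
  ∀ t : ℝ, 0 < t → ∃ g : ℕ, ∀ i, ∀ w : V i → ℝ, (∀ v, 0 ≤ w v) → (G i).IsTrimmable w t g

end SimpleGraph

/-!
Fix a tree decomposition with bags of size at most `q = k + 1` of a graph with maximum degree at
most `d`. The graph then has a *tree partition* with parts of size `s = O(q * d)`: its vertices are
assigned to the nodes of a rooted tree so that adjacent vertices have equal or adjacent nodes. This
is `SimpleGraph.exists_isTreePartition`, proved by induction for a prescribed set `S` in the root
part. If `S` is small, it is made a new root above a tree partition whose root part contains the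
neighbours of `S`. If `S` is large, it is split by a separation of order at most `q` that leaves
many vertices of `S` on both sides (`SimpleGraph.TreeDecomposition.exists_separation`), and the
tree partitions of the two sides are glued at their roots.

For a trimming, the levels of the rooted tree are sorted by residue modulo `t`, and a residue class
with at most a `1 / t` fraction of the weight is removed. A path that avoids it meets at most
`t - 1` consecutive levels, all below its topmost part. Every other part it meets is entered through
an edge from its parent, and only `s * d` edges leave a part, so the path meets at most
`(s * d + 1) ^ (t - 1)` parts of `s` vertices each (`SimpleGraph.IsTreePartition.length_lt`). Hence
it has fewer than `(s * d + 1) ^ t` edges, and `s * d + 1 ≤ (7 * q * d) ^ 2 ≤ ⌈K / 2⌉ ^ 2`.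
-/

namespace SimpleGraph

/-! ### Separations of small order -/

/-- A set `A` of nodes of a tree is *cut off* by the node `x` if every edge of the tree leaving `A`
is incident with `x`. The node `x` itself may or may not belong to `A`. -/
def CutOff {X : Type*} (T : SimpleGraph X) (x : X) (A : Finset X) : Prop :=
  ∀ y z, T.Adj y z → y ∈ A → z ∉ A → y = x ∨ z = x

open Classical in
/-- A set cut off by a node `x` outside it is either the union of two smaller sets cut off by `x`,
or it becomes a set cut off by one of its own nodes when this node is removed. -/
theorem CutOff.exists_split {X : Type*} {T : SimpleGraph X} (hT : T.IsTree) {x : X} {A : Finset X}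
    (hA : T.CutOff x A) (hne : A.Nonempty) (hx : x ∉ A) :
    (∃ A₁ A₂, A₁ ⊂ A ∧ A₂ ⊂ A ∧ A₁ ∪ A₂ = A ∧ T.CutOff x A₁ ∧ T.CutOff x A₂) ∨
      ∃ y ∈ A, T.CutOff y (A.erase y) := by
  obtain ⟨a, ha⟩ := hne
  obtain ⟨p⟩ := hT.connected.preconnected a x
  obtain ⟨e, -, he₁, he₂⟩ := p.exists_boundary_dart (A : Set X) ha hx
  have hyx : T.Adj e.fst x := by
    rcases hA _ _ e.adj he₁ he₂ with h | h
    · exact absurd (h ▸ he₁) hx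
    · exact h ▸ e.adj
  set y := e.fst
  have hy : y ∈ A := he₁
  -- the component of `y` in the forest induced on `A`
  let R : X → Prop := fun z => ∃ p : T.Walk y z, ∀ u ∈ p.support, u ∈ A
  have hRy : R y := ⟨.nil, by simpa using hy⟩
  have hstep : ∀ u v, R u → T.Adj u v → v ∈ A → R v := by
    rintro u v ⟨p, hp⟩ huv hv
    refine ⟨p.concat huv, fun w hw => ?_⟩
    rw [Walk.support_concat] at hw
    simp only [List.mem_append, List.mem_singleton] at hw
    rcases hw with hw | rfl
    exacts [hp w hw, hv]
  by_cases hall : ∀ z ∈ A, R z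
  · refine Or.inr ⟨y, hy, fun u v huv hu hv => ?_⟩
    rw [Finset.mem_erase] at hu hv
    by_cases hvy : v = y
    · exact Or.inr hvy
    exfalso
    have hvA : v ∉ A := fun h => hv ⟨hvy, h⟩
    have hvx : v = x := by
      rcases hA _ _ huv hu.2 hvA with h | h
      · exact absurd (h ▸ hu.2) hx
      · exact h
    subst hvx
    -- two distinct paths from `y` to `u`: one inside `A`, the other through `v`
    obtain ⟨p, hp⟩ := hall u hu.2
    have hq : (Walk.cons hyx (Walk.cons huv.symm Walk.nil)).IsPath := by
      simp [Walk.cons_isPath_iff, huv.ne', hyx.ne, Ne.symm hu.1]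
    have := (hT.isAcyclic.subsingleton_path y u).elim ⟨_, p.bypass_isPath⟩ ⟨_, hq⟩
    have h1 : p.bypass = Walk.cons hyx (Walk.cons huv.symm Walk.nil) := congrArg Subtype.val this
    have h2 : v ∈ p.bypass.support := by rw [h1]; simp
    exact hvA (hp v (p.support_bypass_subset_support h2))
  · push Not at hall
    obtain ⟨z, hz, hRz⟩ := hall
    refine Or.inl ⟨A.filter R, A.filter (fun z => ¬ R z), ?_, ?_, ?_, ?_, ?_⟩
    · exact Finset.filter_ssubset.2 ⟨z, hz, hRz⟩
    · exact Finset.filter_ssubset.2 ⟨y, hy, not_not.2 hRy⟩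
    · exact Finset.filter_union_filter_not_eq _ _
    · intro u v huv hu hv
      rw [Finset.mem_filter] at hu hv
      exact hA u v huv hu.1 fun h => hv ⟨h, hstep u v hu.2 huv h⟩
    · intro u v huv hu hv
      rw [Finset.mem_filter] at hu hv
      exact hA u v huv hu.1 fun h => hv ⟨h, fun hR => hu.2 (hstep v u hR huv.symm hu.1)⟩

namespace TreeDecomposition

variable {V : Type*} {G : SimpleGraph V}

open Classical in
/-- The union of the bags of the nodes in `A`. -/
noncomputable def bags (D : G.TreeDecomposition) (A : Finset D.X) : Finset V :=
  A.biUnion D.bag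

theorem mem_bags {D : G.TreeDecomposition} {A : Finset D.X} {v : V} :
    v ∈ D.bags A ↔ ∃ x ∈ A, v ∈ D.bag x := by
  classical simp [bags]

open Classical in
theorem bags_inter_bags_compl_subset (D : G.TreeDecomposition) {x : D.X} {A : Finset D.X}
    (hA : D.T.CutOff x A) : D.bags A ∩ D.bags Aᶜ ⊆ D.bag x := by
  intro v hv
  rw [Finset.mem_inter, mem_bags, mem_bags] at hv
  obtain ⟨⟨y, hy, hvy⟩, z, hz, hvz⟩ := hv
  rw [Finset.mem_compl] at hz
  obtain ⟨p⟩ := D.isTree.connected.preconnected y z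
  obtain ⟨e, he, he₁, he₂⟩ := p.bypass.exists_boundary_dart (A : Set D.X) hy hz
  refine D.mem_bag_of_mem_path y z _ p.bypass_isPath x ?_ v hvy hvz
  rcases hA _ _ e.adj he₁ he₂ with h | h
  · exact h ▸ Walk.dart_fst_mem_support_of_mem_darts _ he
  · exact h ▸ Walk.dart_snd_mem_support_of_mem_darts _ he

open Classical in
/-- In a tree decomposition with bags of size at most `q ≤ m`, any set `S` of at least `m` vertices
has between `m` and `2 * m` vertices on one side of a separation of order at most `q`. The side is
the union of the bags over a minimal cut-off set of nodes that catches `m` vertices of `S`. -/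
theorem exists_separation (D : G.TreeDecomposition) {q m : ℕ} (hq : ∀ x, (D.bag x).card ≤ q)
    (hm : 0 < m) (hqm : q ≤ m) {S : Finset V} (hS : m ≤ S.card) :
    ∃ A B : Finset V, (∀ v, v ∈ A ∨ v ∈ B) ∧
      (∀ u v, G.Adj u v → (u ∈ A ∧ v ∈ A) ∨ (u ∈ B ∧ v ∈ B)) ∧
      (A ∩ B).card ≤ q ∧ m ≤ (S ∩ A).card ∧ (S ∩ A).card < 2 * m := by
  let F : Finset (Finset D.X) :=
    Finset.univ.filter fun A => (∃ x, D.T.CutOff x A) ∧ m ≤ (S ∩ D.bags A).card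
  have hF : F.Nonempty := by
    obtain ⟨x⟩ := D.isTree.connected.nonempty
    refine ⟨Finset.univ, Finset.mem_filter.2 ⟨Finset.mem_univ _, ⟨x, fun y z _ _ hz => ?_⟩, ?_⟩⟩
    · exact absurd (Finset.mem_univ z) hz
    · have : S ∩ D.bags Finset.univ = S := Finset.inter_eq_left.2 fun v _ => by
        obtain ⟨y, hy⟩ := D.exists_mem_bag v
        exact mem_bags.2 ⟨y, Finset.mem_univ y, hy⟩
      rwa [this]
  obtain ⟨A, hAF, hmin⟩ := F.exists_min_image Finset.card hF
  obtain ⟨-, ⟨x, hA⟩, hmA⟩ := Finset.mem_filter.1 hAF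
  have hlt : ∀ A', A' ⊂ A → (∃ x, D.T.CutOff x A') → (S ∩ D.bags A').card < m := by
    intro A' hA' hx
    by_contra! h
    exact absurd (hmin A' (Finset.mem_filter.2 ⟨Finset.mem_univ _, hx, h⟩))
      (not_le.2 (Finset.card_lt_card hA'))
  have hunion : ∀ A₁ A₂, A₁ ∪ A₂ = A →
      (S ∩ D.bags A).card ≤ (S ∩ D.bags A₁).card + (S ∩ D.bags A₂).card := by
    rintro A₁ A₂ rfl
    rw [bags, Finset.union_biUnion, Finset.inter_union_distrib_left]
    exact Finset.card_union_le _ _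
  have herase : ∀ y ∈ A, D.T.CutOff y (A.erase y) → (S ∩ D.bags A).card < 2 * m := by
    intro y hy h
    have h1 := hlt _ (Finset.erase_ssubset hy) ⟨y, h⟩
    have h2 := hunion (A.erase y) {y} (by
      rw [Finset.union_comm, ← Finset.insert_eq, Finset.insert_erase hy])
    have h3 : (S ∩ D.bags {y}).card ≤ q :=
      (Finset.card_le_card (by rw [bags, Finset.singleton_biUnion]; exact
        Finset.inter_subset_right)).trans (hq y)
    omega
  have hne : A.Nonempty := by
    rw [Finset.nonempty_iff_ne_empty]
    rintro rfl
    simp [bags] at hmA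
    omega
  refine ⟨D.bags A, D.bags Aᶜ, fun v => ?_, fun u v huv => ?_,
    (Finset.card_le_card (D.bags_inter_bags_compl_subset hA)).trans (hq x), hmA, ?_⟩
  · obtain ⟨y, hy⟩ := D.exists_mem_bag v
    by_cases h : y ∈ A
    · exact Or.inl (mem_bags.2 ⟨y, h, hy⟩)
    · exact Or.inr (mem_bags.2 ⟨y, Finset.mem_compl.2 h, hy⟩)
  · obtain ⟨y, hu, hv⟩ := D.exists_adj_mem_bag u v huv
    by_cases h : y ∈ A
    · exact Or.inl ⟨mem_bags.2 ⟨y, h, hu⟩, mem_bags.2 ⟨y, h, hv⟩⟩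
    · exact Or.inr ⟨mem_bags.2 ⟨y, Finset.mem_compl.2 h, hu⟩,
        mem_bags.2 ⟨y, Finset.mem_compl.2 h, hv⟩⟩
  · by_cases hx : x ∈ A
    · refine herase x hx fun y z hyz hy hz => ?_
      rw [Finset.mem_erase] at hy hz
      by_cases hzx : z = x
      · exact Or.inr hzx
      · exact hA y z hyz hy.2 fun h => hz ⟨hzx, h⟩
    · rcases hA.exists_split D.isTree hne hx with ⟨A₁, A₂, h₁, h₂, hU, hc₁, hc₂⟩ | ⟨y, hy, hc⟩
      · have := hlt A₁ h₁ ⟨x, hc₁⟩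
        have := hlt A₂ h₂ ⟨x, hc₂⟩
        have := hunion A₁ A₂ hU
        omega
      · exact herase y hy hc

end TreeDecomposition

/-! ### Rooted tree partitions -/

/-- Finite sequences of naturals are the nodes of an infinite rooted tree: the root is `[]` and the
children of `a` are the sequences `n :: a`. Two nodes are near if they are equal or adjacent. -/
def Near (a b : List ℕ) : Prop := a = b ∨ (∃ n, a = n :: b) ∨ ∃ n, b = n :: a

theorem Near.map {a b : List ℕ} (h : Near a b) (f : ℕ → ℕ) : Near (a.map f) (b.map f) := by
  rcases h with rfl | ⟨n, rfl⟩ | ⟨n, rfl⟩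
  · exact Or.inl rfl
  · exact Or.inr (Or.inl ⟨f n, rfl⟩)
  · exact Or.inr (Or.inr ⟨f n, rfl⟩)

theorem Near.append {a b : List ℕ} (h : Near a b) (c : List ℕ) : Near (a ++ c) (b ++ c) := by
  rcases h with rfl | ⟨n, rfl⟩ | ⟨n, rfl⟩
  · exact Or.inl rfl
  · exact Or.inr (Or.inl ⟨n, rfl⟩)
  · exact Or.inr (Or.inr ⟨n, rfl⟩)

theorem Near.symm {a b : List ℕ} (h : Near a b) : Near b a := by
  rcases h with rfl | h | h
  · exact Or.inl rfl
  · exact Or.inr (Or.inr h)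
  · exact Or.inr (Or.inl h)

theorem Near.length_le {a b : List ℕ} (h : Near a b) : b.length ≤ a.length + 1 := by
  rcases h with rfl | ⟨n, rfl⟩ | ⟨n, rfl⟩
  · exact Nat.le_succ _
  · simp only [List.length_cons]
    omega
  · exact le_rfl

/-- `π` is a tree partition of the subgraph of `G` induced on `R`: each vertex is assigned to a node
of the rooted tree of sequences so that adjacent vertices have equal or adjacent nodes. The root
part contains `S` and has size at most `r`; all parts have size at most `s`. Values of `π` outside
`R` are irrelevant. -/
structure IsTreePartition {V : Type*} (G : SimpleGraph V) (R S : Finset V) (r s : ℕ)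
    (π : V → List ℕ) : Prop where
  subset : S ⊆ R
  near : ∀ u ∈ R, ∀ v ∈ R, G.Adj u v → Near (π u) (π v)
  root : ∀ v ∈ S, π v = []
  card_root_le : (R.filter (π · = [])).card ≤ r
  card_part_le : ∀ a, (R.filter (π · = a)).card ≤ s

variable {V : Type*} {G : SimpleGraph V}

open Classical in
/-- Putting a new root part `S` above a tree partition of `R \ S` whose root part contains all
neighbours of `S`. -/
theorem IsTreePartition.add_root {R S S' : Finset V} {r r' s : ℕ} {π : V → List ℕ} (hSR : S ⊆ R)
    (h : G.IsTreePartition (R \ S) S' r' s π)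
    (hS' : ∀ u ∈ S, ∀ v ∈ R \ S, G.Adj u v → v ∈ S') (hr : S.card ≤ r) (hs : S.card ≤ s) :
    G.IsTreePartition R S r s (fun v => if v ∈ S then [] else π v ++ [0]) := by
  have hroot : R.filter (fun v => (if v ∈ S then [] else π v ++ [0]) = []) ⊆ S := by
    intro v hv
    by_contra hvS
    simp [hvS] at hv
  have hedge : ∀ u ∈ S, ∀ v ∈ R \ S, G.Adj u v → Near [] (π v ++ [0]) := by
    intro u hu v hv huv
    rw [h.root v (hS' u hu v hv huv)]
    exact Or.inr (Or.inr ⟨0, rfl⟩)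
  refine ⟨hSR, fun u hu v hv huv => ?_, fun v hv => if_pos hv,
    (Finset.card_le_card hroot).trans hr, fun a => ?_⟩
  · by_cases hu' : u ∈ S <;> by_cases hv' : v ∈ S <;> simp only [hu', hv', if_true, if_false]
    · exact Or.inl rfl
    · exact hedge u hu' v (Finset.mem_sdiff.2 ⟨hv, hv'⟩) huv
    · exact (hedge v hv' u (Finset.mem_sdiff.2 ⟨hu, hu'⟩) huv.symm).symm
    · exact (h.near u (Finset.mem_sdiff.2 ⟨hu, hu'⟩) v (Finset.mem_sdiff.2 ⟨hv, hv'⟩) huv).append _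
  · by_cases ha : a = []
    · subst ha
      exact (Finset.card_le_card hroot).trans hs
    · refine (Finset.card_le_card fun v hv => ?_).trans (h.card_part_le a.dropLast)
      rw [Finset.mem_filter] at hv ⊢
      by_cases hvS : v ∈ S
      · simp only [hvS, if_true] at hv
        exact absurd hv.2.symm ha
      · simp only [hvS, if_false] at hv
        exact ⟨Finset.mem_sdiff.2 ⟨hv.1, hvS⟩, by rw [← hv.2, List.dropLast_concat]⟩

open Classical in
/-- Gluing tree partitions of the two sides of a separation along their root parts. Relabelling
makes the children of the root even on one side and odd on the other side. -/
theorem IsTreePartition.glue {R₁ R₂ S₁ S₂ : Finset V} {r₁ r₂ s : ℕ} {π₁ π₂ : V → List ℕ}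
    (h₁ : G.IsTreePartition R₁ S₁ r₁ s π₁) (h₂ : G.IsTreePartition R₂ S₂ r₂ s π₂)
    (hI₁ : R₁ ∩ R₂ ⊆ S₁) (hI₂ : R₁ ∩ R₂ ⊆ S₂)
    (hadj : ∀ u ∈ R₁ ∪ R₂, ∀ v ∈ R₁ ∪ R₂, G.Adj u v → (u ∈ R₁ ∧ v ∈ R₁) ∨ (u ∈ R₂ ∧ v ∈ R₂))
    (hs : r₁ + r₂ ≤ s) :
    G.IsTreePartition (R₁ ∪ R₂) (S₁ ∪ S₂) (r₁ + r₂) s (fun v =>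
      if v ∈ R₁ then (π₁ v).map (fun n => 2 * n) else (π₂ v).map (fun n => 2 * n + 1)) := by
  set π : V → List ℕ := fun v =>
    if v ∈ R₁ then (π₁ v).map (fun n => 2 * n) else (π₂ v).map (fun n => 2 * n + 1)
  have e₁ : ∀ v ∈ R₁, π v = (π₁ v).map (fun n => 2 * n) := fun v hv => if_pos hv
  have e₂ : ∀ v ∈ R₂, π v = (π₂ v).map (fun n => 2 * n + 1) := by
    intro v hv
    by_cases h : v ∈ R₁
    · have hI := Finset.mem_inter.2 ⟨h, hv⟩
      rw [e₁ v h, h₁.root v (hI₁ hI), h₂.root v (hI₂ hI)]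
      rfl
    · exact if_neg h
  have hsub : ∀ a, (R₁ ∪ R₂).filter (π · = a) ⊆
      R₁.filter (fun v => (π₁ v).map (fun n => 2 * n) = a) ∪
        R₂.filter (fun v => (π₂ v).map (fun n => 2 * n + 1) = a) := by
    intro a v hv
    rw [Finset.mem_filter, Finset.mem_union] at hv
    rw [Finset.mem_union, Finset.mem_filter, Finset.mem_filter]
    rcases hv with ⟨hv | hv, ha⟩
    · exact Or.inl ⟨hv, e₁ v hv ▸ ha⟩
    · exact Or.inr ⟨hv, e₂ v hv ▸ ha⟩
  have hroot : ((R₁ ∪ R₂).filter (π · = [])).card ≤ r₁ + r₂ := by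
    refine (Finset.card_le_card (hsub [])).trans ((Finset.card_union_le _ _).trans ?_)
    simp only [List.map_eq_nil_iff]
    exact add_le_add h₁.card_root_le h₂.card_root_le
  -- halving recovers the original node on either side
  have half₁ : ∀ l : List ℕ, (l.map (fun n => 2 * n)).map (· / 2) = l := by
    intro l
    rw [List.map_map]
    exact (List.map_congr_left fun n _ => by simp).trans (List.map_id l)
  have half₂ : ∀ l : List ℕ, (l.map (fun n => 2 * n + 1)).map (· / 2) = l := by
    intro l
    rw [List.map_map]
    exact (List.map_congr_left fun n _ => by simp; omega).trans (List.map_id l)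
  refine ⟨Finset.union_subset_union h₁.subset h₂.subset, fun u hu v hv huv => ?_, fun v hv => ?_,
    hroot, fun a => ?_⟩
  · rcases hadj u hu v hv huv with ⟨hu, hv⟩ | ⟨hu, hv⟩
    · rw [e₁ u hu, e₁ v hv]
      exact (h₁.near u hu v hv huv).map _
    · rw [e₂ u hu, e₂ v hv]
      exact (h₂.near u hu v hv huv).map _
  · rcases Finset.mem_union.1 hv with hv | hv
    · rw [e₁ v (h₁.subset hv), h₁.root v hv, List.map_nil]
    · rw [e₂ v (h₂.subset hv), h₂.root v hv, List.map_nil]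
  · match a with
    | [] => exact hroot.trans hs
    | n :: b =>
      rcases Nat.even_or_odd n with hn | hn
      · refine (Finset.card_le_card fun v hv => ?_).trans
          (h₁.card_part_le ((n :: b).map (· / 2)))
        have := hsub _ hv
        rw [Finset.mem_union, Finset.mem_filter, Finset.mem_filter] at this
        rcases this with ⟨hv, h⟩ | ⟨hv, h⟩
        · exact Finset.mem_filter.2 ⟨hv, by rw [← h, half₁]⟩
        · obtain ⟨c, l, -, rfl, -⟩ := List.map_eq_cons_iff.1 h
          exact absurd hn (by simp)
      · refine (Finset.card_le_card fun v hv => ?_).trans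
          (h₂.card_part_le ((n :: b).map (· / 2)))
        have := hsub _ hv
        rw [Finset.mem_union, Finset.mem_filter, Finset.mem_filter] at this
        rcases this with ⟨hv, h⟩ | ⟨hv, h⟩
        · obtain ⟨c, l, -, rfl, -⟩ := List.map_eq_cons_iff.1 h
          exact absurd hn (by simp)
        · exact Finset.mem_filter.2 ⟨hv, by rw [← h, half₂]⟩

open Classical in
/-- A graph of treewidth less than `q` and maximum degree at most `d` has a tree partition with
parts of size at most `24 * q * d`, with any prescribed set `S` of suitable size in the root part.
A small `S` becomes a new root part above a tree partition whose root part contains the neighbours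
of `S`. A large `S` is split by a separation. The bound `2 * |S| - 4 * q` on the root part is
chosen so that splitting preserves it: each side inherits up to `q` new vertices. -/
theorem exists_isTreePartition [Fintype V] [DecidableRel G.Adj] (D : G.TreeDecomposition) {q d : ℕ}
    (hq : ∀ x, (D.bag x).card ≤ q) (hq₀ : 0 < q) (hd₀ : 0 < d) (hd : ∀ v, G.degree v ≤ d)
    (R S : Finset V) (hSR : S ⊆ R) (hS : 4 * q ≤ S.card) (hS' : S.card ≤ 12 * q * d) :
    ∃ π, G.IsTreePartition R S (2 * S.card - 4 * q) (24 * q * d) π := by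
  -- a new root moves `S'` out of `R \ S`, lowering the measure by `|S|` and `|S'|`; a separation
  -- does not enlarge `R \ S` and makes `S` smaller
  induction hN : 2 * (R \ S).card + S.card using Nat.strong_induction_on generalizing R S with
  | _ N ih =>
  subst hN
  have hqd : q ≤ q * d := Nat.le_mul_of_pos_right q hd₀
  have e12 : 12 * q * d = 12 * (q * d) := by ring
  have e24 : 24 * q * d = 24 * (q * d) := by ring
  rw [e12] at hS'
  rw [e24]
  by_cases hsmall : (R \ S).card < 4 * q
  · have hbase : G.IsTreePartition (R \ S) (R \ S) (4 * q) (24 * (q * d)) (fun _ => []) :=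
      ⟨subset_rfl, fun _ _ _ _ _ => Or.inl rfl, fun _ _ => rfl,
        (Finset.card_filter_le _ _).trans hsmall.le,
        fun _ => (Finset.card_filter_le _ _).trans (by omega)⟩
    exact ⟨_, hbase.add_root hSR (fun _ _ v hv _ => hv) (by omega) (by omega)⟩
  by_cases hS12 : S.card ≤ 12 * q
  · let N := (S.biUnion fun v => G.neighborFinset v) ∩ (R \ S)
    have hN : N.card ≤ 12 * (q * d) :=
      calc N.card ≤ (S.biUnion fun v => G.neighborFinset v).card :=
            Finset.card_le_card Finset.inter_subset_left
        _ ≤ S.card * d := Finset.card_biUnion_le_card_mul _ _ _ fun v _ => hd v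
        _ ≤ 12 * q * d := Nat.mul_le_mul_right d hS12
        _ = _ := e12
    have hNR : N ⊆ R \ S := Finset.inter_subset_right
    obtain ⟨S', hNS', hS'R, hS'card⟩ := Finset.exists_subsuperset_card_eq hNR
      (le_max_left N.card (4 * q)) (max_le (Finset.card_le_card hNR) (not_lt.1 hsmall))
    have h4 : 4 * q ≤ S'.card := hS'card ▸ le_max_right _ _
    have h12 : S'.card ≤ 12 * q * d := by
      rw [hS'card, e12]
      exact max_le hN (by omega)
    have hdiff := Finset.card_sdiff_add_card_eq_card hS'R
    obtain ⟨π, hπ⟩ := ih _ (by omega) (R \ S) S' hS'R h4 h12 rfl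
    rw [e24] at hπ
    refine ⟨_, hπ.add_root hSR (fun u hu v hv huv => hNS' ?_) (by omega) (by omega)⟩
    exact Finset.mem_inter.2 ⟨Finset.mem_biUnion.2 ⟨u, hu, by simpa using huv⟩, hv⟩
  · obtain ⟨A, B, hAB, hadj, hI, hA₁, hA₂⟩ :=
      D.exists_separation (m := 4 * q) hq (by omega) (by omega) hS
    have hC : (R ∩ (A ∩ B)).card ≤ q := (Finset.card_le_card Finset.inter_subset_right).trans hI
    set C := R ∩ (A ∩ B) with hCdef
    let S₁ := S ∩ A ∪ C
    let S₂ := S ∩ B ∪ C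
    have hSU : S = S ∩ A ∪ S ∩ B := by
      ext v
      have := hAB v
      simp only [Finset.mem_union, Finset.mem_inter]
      tauto
    have hRU : R = R ∩ A ∪ R ∩ B := by
      ext v
      have := hAB v
      simp only [Finset.mem_union, Finset.mem_inter]
      tauto
    have hcard : S.card ≤ (S ∩ A).card + (S ∩ B).card := by
      conv_lhs => rw [hSU]
      exact Finset.card_union_le _ _
    have hU : (S₁ ∪ S₂).card ≤ S.card + q := by
      have : S₁ ∪ S₂ ⊆ S ∪ C := by
        intro v
        simp only [S₁, S₂, Finset.mem_union, Finset.mem_inter]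
        tauto
      exact (Finset.card_le_card this).trans ((Finset.card_union_le _ _).trans (by omega))
    have hIn : (S₁ ∩ S₂).card ≤ q := by
      refine (Finset.card_le_card fun v hv => ?_).trans hC
      have := @hSR v
      simp only [S₁, S₂, hCdef, Finset.mem_union, Finset.mem_inter] at hv ⊢
      tauto
    have hsum := Finset.card_union_add_card_inter S₁ S₂
    have h₁ : (S ∩ A).card ≤ S₁.card := Finset.card_le_card Finset.subset_union_left
    have h₂ : (S ∩ B).card ≤ S₂.card := Finset.card_le_card Finset.subset_union_left
    have hS₁R : S₁ ⊆ R ∩ A := by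
      intro v
      have := @hSR v
      simp only [S₁, hCdef, Finset.mem_union, Finset.mem_inter]
      tauto
    have hS₂R : S₂ ⊆ R ∩ B := by
      intro v
      have := @hSR v
      simp only [S₂, hCdef, Finset.mem_union, Finset.mem_inter]
      tauto
    have hd₁ : ((R ∩ A) \ S₁).card ≤ (R \ S).card := Finset.card_le_card fun v => by
      simp only [S₁, hCdef, Finset.mem_union, Finset.mem_inter, Finset.mem_sdiff]
      tauto
    have hd₂ : ((R ∩ B) \ S₂).card ≤ (R \ S).card := Finset.card_le_card fun v => by
      simp only [S₂, hCdef, Finset.mem_union, Finset.mem_inter, Finset.mem_sdiff]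
      tauto
    obtain ⟨π₁, hπ₁⟩ := ih _ (by omega) (R ∩ A) S₁ hS₁R (by omega) (by omega) rfl
    obtain ⟨π₂, hπ₂⟩ := ih _ (by omega) (R ∩ B) S₂ hS₂R (by omega) (by omega) rfl
    rw [e24] at hπ₁ hπ₂
    have hCI : R ∩ A ∩ (R ∩ B) = C := by
      rw [hCdef, ← Finset.inter_inter_distrib_left]
    have hglue := hπ₁.glue hπ₂ (hCI ▸ Finset.subset_union_right)
      (hCI ▸ Finset.subset_union_right) (by
        rw [← hRU]
        intro u hu v hv huv
        simp only [Finset.mem_inter]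
        have := hadj u v huv
        tauto) (by omega)
    rw [← hRU] at hglue
    refine ⟨_, hSR, hglue.near, fun v hv => hglue.root v ?_, hglue.card_root_le.trans (by omega),
      hglue.card_part_le⟩
    rw [hSU] at hv
    exact Finset.union_subset_union Finset.subset_union_left Finset.subset_union_left hv

/-! ### Paths between removed levels -/

theorem Walk.exists_adj_boundary {u v : V} (p : G.Walk u v) (A : Set V) {x z : V}
    (hx : x ∈ p.support) (hz : z ∈ p.support) (hxA : x ∈ A) (hzA : z ∉ A) :
    ∃ a ∈ p.support, ∃ b ∈ p.support, G.Adj a b ∧ a ∈ A ∧ b ∉ A := by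
  classical
  by_cases hu : u ∈ A
  · obtain ⟨e, he, h₁, h₂⟩ := (p.takeUntil z hz).exists_boundary_dart A hu hzA
    have he' := p.darts_takeUntil_subset_darts hz he
    exact ⟨_, p.dart_fst_mem_support_of_mem_darts he', _, p.dart_snd_mem_support_of_mem_darts he',
      e.adj, h₁, h₂⟩
  · obtain ⟨e, he, h₁, h₂⟩ := (p.takeUntil x hx).exists_boundary_dart Aᶜ hu (not_not.2 hxA)
    have he' := p.darts_takeUntil_subset_darts hx he
    exact ⟨_, p.dart_snd_mem_support_of_mem_darts he', _, p.dart_fst_mem_support_of_mem_darts he',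
      e.adj.symm, not_not.1 h₂, h₁⟩

open Classical in
/-- A path that avoids the levels `≡ i` modulo `t` of a tree partition stays within `t - 1` levels
below its topmost part. As each part is entered through an edge from its parent, it meets at most
`(s * d + 1) ^ (t - 1)` parts. -/
theorem IsTreePartition.length_lt [Fintype V] [DecidableRel G.Adj] {S : Finset V} {r s d t i : ℕ}
    {π : V → List ℕ} (h : G.IsTreePartition Finset.univ S r s π) (hd : ∀ v, G.degree v ≤ d)
    (hit : i < t) {u v : V} (p : G.Walk u v) (hp : p.IsPath)
    (hi : ∀ x ∈ p.support, (π x).length % t ≠ i) :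
    p.length < (s * d + 1) ^ (t - 1) * s := by
  have near : ∀ a b, G.Adj a b → Near (π a) (π b) := fun a b =>
    h.near a (Finset.mem_univ a) b (Finset.mem_univ b)
  obtain ⟨x, hx, hmin⟩ := p.support.toFinset.exists_min_image (fun x => (π x).length)
    ⟨u, by simp⟩
  rw [List.mem_toFinset] at hx
  replace hmin : ∀ z ∈ p.support, (π x).length ≤ (π z).length :=
    fun z hz => hmin z (List.mem_toFinset.2 hz)
  set l := (π x).length with hl
  -- the first removed level below the topmost part
  obtain ⟨c, hlc, hct, hci⟩ : ∃ c, l < c ∧ c < l + t ∧ c % t = i := by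
    have h₁ := Nat.div_add_mod l t
    have h₂ := Nat.mod_lt l (by omega : 0 < t)
    have h₃ : l % t ≠ i := hi x hx
    by_cases hlt : l % t < i
    · refine ⟨t * (l / t) + i, by omega, by omega, ?_⟩
      rw [Nat.mul_add_mod, Nat.mod_eq_of_lt hit]
    · refine ⟨t * (l / t) + (t + i), by omega, by omega, ?_⟩
      rw [Nat.mul_add_mod, Nat.add_mod_left, Nat.mod_eq_of_lt hit]
  have hbelow : ∀ z ∈ p.support, π x <:+ π z ∧ (π z).length < c := by
    intro z hz
    by_contra hcon
    obtain ⟨a, ha, b, hb, hab, ⟨haA, hac⟩, hbA⟩ := p.exists_adj_boundary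
      {z | π x <:+ π z ∧ (π z).length < c} hx hz ⟨List.suffix_rfl, hlc⟩ hcon
    refine hbA ⟨?_, ?_⟩
    · rcases near a b hab with e | ⟨n, e⟩ | ⟨n, e⟩
      · exact e ▸ haA
      · rw [e, List.suffix_cons_iff] at haA
        rcases haA with e' | h'
        · have h₁ := hmin b hb
          have h₂ := congrArg List.length e'
          rw [List.length_cons] at h₂
          omega
        · exact h'
      · exact e ▸ haA.trans (List.suffix_cons _ _)
    · have h₁ := (near a b hab).length_le
      have h₂ : (π b).length ≠ c := fun e => hi b hb (e ▸ hci)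
      omega
  let P : ℕ → Finset (List ℕ) := fun j =>
    (p.support.toFinset.image π).filter fun a => a.length ≤ l + j
  have hP : ∀ j, (P j).card ≤ (s * d + 1) ^ j := by
    intro j
    induction j with
    | zero =>
      rw [pow_zero]
      refine Finset.card_le_one_iff_subset_singleton.2 ⟨π x, fun a ha => ?_⟩
      obtain ⟨ha, hal⟩ := Finset.mem_filter.1 ha
      obtain ⟨z, hz, rfl⟩ := Finset.mem_image.1 ha
      rw [List.mem_toFinset] at hz
      rw [Finset.mem_singleton]
      exact ((hbelow z hz).1.eq_of_length (le_antisymm (hmin z hz) hal)).symm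
    | succ j ih =>
      let Q : List ℕ → Finset (List ℕ) := fun a =>
        ((Finset.univ.filter (π · = a)).biUnion fun v => G.neighborFinset v).image π
      have hQ : ∀ a ∈ P j, (Q a).card ≤ s * d := fun a _ =>
        Finset.card_image_le.trans ((Finset.card_biUnion_le_card_mul _ _ _ fun v _ => hd v).trans
          (Nat.mul_le_mul_right d (h.card_part_le a)))
      have hsub : P (j + 1) ⊆ insert (π x) ((P j).biUnion Q) := by
        intro a ha
        obtain ⟨ha, hal⟩ := Finset.mem_filter.1 ha
        obtain ⟨z, hz, rfl⟩ := Finset.mem_image.1 ha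
        rw [List.mem_toFinset] at hz
        rw [Finset.mem_insert]
        by_cases hzx : π z = π x
        · exact Or.inl hzx
        right
        -- the edge through which the path enters the subtree below `π z`
        obtain ⟨a, ha, b, hb, hab, haA, hbA⟩ := p.exists_adj_boundary {v | ¬ π z <:+ π v} hx hz
          (fun hs => hzx (hs.eq_of_length_le (hmin z hz))) (not_not.2 List.suffix_rfl)
        have hbA : π z <:+ π b := not_not.1 hbA
        have haA : ¬ π z <:+ π a := haA
        rcases near a b hab with e | ⟨n, e⟩ | ⟨n, e⟩
        · exact absurd (e ▸ hbA) haA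
        · exact absurd (e ▸ hbA.trans (List.suffix_cons n _)) haA
        · have hzb : π z = π b := by
            rw [e, List.suffix_cons_iff] at hbA
            rw [e]
            exact hbA.resolve_right haA
          have hlen : (π b).length = (π a).length + 1 := by rw [e, List.length_cons]
          refine Finset.mem_biUnion.2 ⟨π a, Finset.mem_filter.2 ⟨Finset.mem_image.2
            ⟨a, List.mem_toFinset.2 ha, rfl⟩, ?_⟩, Finset.mem_image.2
            ⟨b, Finset.mem_biUnion.2 ⟨a, by simp, by simpa using hab⟩, hzb.symm⟩⟩
          rw [hzb] at hal
          omega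
      calc (P (j + 1)).card ≤ ((P j).biUnion Q).card + 1 :=
            (Finset.card_le_card hsub).trans (Finset.card_insert_le _ _)
        _ ≤ (P j).card * (s * d) + 1 :=
            Nat.add_le_add_right (Finset.card_biUnion_le_card_mul _ _ _ hQ) 1
        _ ≤ (s * d + 1) ^ j * (s * d) + (s * d + 1) ^ j :=
            add_le_add (Nat.mul_le_mul_right _ ih) (Nat.one_le_pow _ _ (Nat.succ_pos _))
        _ = (s * d + 1) ^ (j + 1) := by ring
  have hcover : p.support.toFinset ⊆
      (P (t - 1)).biUnion fun a => Finset.univ.filter (π · = a) := by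
    intro z hz
    refine Finset.mem_biUnion.2 ⟨π z, Finset.mem_filter.2 ⟨Finset.mem_image_of_mem π hz, ?_⟩,
      by simp⟩
    have := (hbelow z (List.mem_toFinset.1 hz)).2
    omega
  calc p.length < p.support.toFinset.card := by
        rw [List.toFinset_card_of_nodup hp.support_nodup, Walk.length_support]
        exact Nat.lt_succ_self _
    _ ≤ (P (t - 1)).card * s := (Finset.card_le_card hcover).trans
        (Finset.card_biUnion_le_card_mul _ _ _ fun a _ => h.card_part_le a)
    _ ≤ _ := Nat.mul_le_mul_right s (hP (t - 1))

open Classical in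
/-- One of the `t` residue classes of a labelling carries at most a `1 / t` fraction of the
weight. -/
theorem exists_residue_weight_le [Fintype V] (w : V → ℝ) (ℓ : V → ℕ) {t : ℕ} (ht : 0 < t) :
    ∃ i < t, ∑ v with ℓ v % t = i, w v ≤ (∑ v, w v) / t := by
  have hsum : ∑ i ∈ Finset.range t, ∑ v with ℓ v % t = i, w v ≤
      ∑ _i ∈ Finset.range t, (∑ v, w v) / t := by
    rw [Finset.sum_fiberwise_of_maps_to fun v _ => Finset.mem_range.2 (Nat.mod_lt _ ht),
      Finset.sum_const, Finset.card_range, nsmul_eq_mul, mul_div_cancel₀ _ (by positivity)]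
  obtain ⟨i, hi, h⟩ := Finset.exists_le_of_sum_le ⟨0, Finset.mem_range.2 ht⟩ hsum
  exact ⟨i, Finset.mem_range.1 hi, h⟩

theorem IsTrimmable.mono [Fintype V] {w : V → ℝ} (hw : ∀ v, 0 ≤ w v) {t t' : ℝ} {g g' : ℕ}
    (h : G.IsTrimmable w t' g) (ht : 0 < t) (htt' : t ≤ t') (hg : g ≤ g') :
    G.IsTrimmable w t g' := by
  obtain ⟨U, hU, hp⟩ := h
  exact ⟨U, hU.trans (div_le_div_of_nonneg_left (Finset.sum_nonneg fun v _ => hw v) ht htt'),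
    fun u v p hpath hlen => hp u v p hpath (hg.trans_lt hlen)⟩

/-! ### Graphs of bounded treewidth and degree -/

theorem exists_treeDecomposition_card_bag_le [Fintype V] {k : ℕ} (h : G.treewidth ≤ (k : ℤ)) :
    ∃ D : G.TreeDecomposition, ∀ x, (D.bag x).card ≤ k + 1 := by
  -- the one-bag decomposition and the bound `-1` ensure that the infimum is attained
  have hne : {m : ℤ | ∃ D : G.TreeDecomposition, D.width = m}.Nonempty :=
    ⟨_, { X := Unit
          T := ⊥
          isTree := SimpleGraph.IsTree.of_subsingleton
          bag := fun _ => Finset.univ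
          exists_mem_bag := fun v => ⟨(), Finset.mem_univ v⟩
          exists_adj_mem_bag := fun u v _ => ⟨(), Finset.mem_univ u, Finset.mem_univ v⟩
          mem_bag_of_mem_path := fun _ _ _ _ _ _ v _ _ => Finset.mem_univ v }, rfl⟩
  have hbdd : BddBelow {m : ℤ | ∃ D : G.TreeDecomposition, D.width = m} := by
    refine ⟨-1, ?_⟩
    rintro _ ⟨D, rfl⟩
    unfold TreeDecomposition.width
    omega
  obtain ⟨D, hD⟩ := Int.csInf_mem hne hbdd
  refine ⟨D, fun x => ?_⟩
  have h₁ : D.width ≤ k := hD.trans_le h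
  have h₂ := Finset.le_sup (f := fun x => (D.bag x).card) (Finset.mem_univ x)
  unfold TreeDecomposition.width at h₁
  omega

open Classical in
theorem exists_isTreePartition_univ [Fintype V] [DecidableRel G.Adj] {k d : ℕ}
    (hk : G.treewidth ≤ (k : ℤ)) (hd₀ : 0 < d) (hd : ∀ v, G.degree v ≤ d) :
    ∃ S r π, G.IsTreePartition Finset.univ S r (24 * (k + 1) * d) π := by
  obtain ⟨D, hD⟩ := exists_treeDecomposition_card_bag_le hk
  have hle : k + 1 ≤ (k + 1) * d := Nat.le_mul_of_pos_right _ hd₀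
  have e₁ : 24 * (k + 1) * d = 24 * ((k + 1) * d) := by ring
  have e₂ : 12 * (k + 1) * d = 12 * ((k + 1) * d) := by ring
  by_cases hV : 4 * (k + 1) ≤ (Finset.univ : Finset V).card
  · obtain ⟨S, hS, hcard⟩ := Finset.exists_subset_card_eq hV
    obtain ⟨π, hπ⟩ := exists_isTreePartition D hD (Nat.succ_pos k) hd₀ hd Finset.univ S hS hcard.ge
      (by omega)
    exact ⟨S, _, π, hπ⟩
  · exact ⟨∅, _, fun _ => [], Finset.empty_subset _, fun _ _ _ _ _ => Or.inl rfl,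
      fun _ _ => rfl, le_rfl, fun _ => (Finset.card_filter_le _ _).trans (by omega)⟩

/-- Trimming a level class modulo `t` of a tree partition. -/
theorem isTrimmable_of_treewidth_le [Fintype V] [DecidableRel G.Adj] {k d t : ℕ} (hd₀ : 0 < d)
    (ht : 0 < t) (w : V → ℝ) (hk : G.treewidth ≤ (k : ℤ)) (hd : G.maxDegree ≤ d) :
    G.IsTrimmable w t ((7 * (k + 1) * d) ^ (2 * t)) := by
  classical
  have hd' : ∀ v, G.degree v ≤ d := fun v => (G.degree_le_maxDegree v).trans hd
  obtain ⟨S, r, π, hπ⟩ := exists_isTreePartition_univ hk hd₀ hd'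
  obtain ⟨i, hit, hi⟩ := exists_residue_weight_le w (fun v => (π v).length) ht
  refine ⟨_, hi, fun u v p hp hlen => ?_⟩
  by_contra! hcon
  have hlt := hπ.length_lt hd' hit p hp fun x hx e => hcon x hx (by simpa using e)
  refine absurd hlen (not_lt.2 (hlt.le.trans ?_))
  set s := 24 * (k + 1) * d
  have hs : s ≤ s * d + 1 := (Nat.le_mul_of_pos_right s hd₀).trans (Nat.le_succ _)
  have hsq : s * d + 1 ≤ (7 * (k + 1) * d) ^ 2 := by
    have h₁ : 1 ≤ (k + 1) * d ^ 2 := Nat.mul_pos (Nat.succ_pos k) (pow_pos hd₀ 2)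
    calc s * d + 1 = 24 * ((k + 1) * d ^ 2) + 1 := by ring
      _ ≤ 49 * ((k + 1) * d ^ 2) := by omega
      _ ≤ (k + 1) * (49 * ((k + 1) * d ^ 2)) := Nat.le_mul_of_pos_left _ (Nat.succ_pos k)
      _ = (7 * (k + 1) * d) ^ 2 := by ring
  calc (s * d + 1) ^ (t - 1) * s ≤ (s * d + 1) ^ (t - 1) * (s * d + 1) := Nat.mul_le_mul_left _ hs
    _ = (s * d + 1) ^ t := by rw [← pow_succ, Nat.sub_add_cancel ht]
    _ ≤ ((7 * (k + 1) * d) ^ 2) ^ t := Nat.pow_le_pow_left hsq t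
    _ = _ := (pow_mul _ _ _).symm

theorem seven_mul_le_ceil {k d : ℕ} (hd : 1 ≤ d) :
    7 * (k + 1) * d ≤ ⌈((9 * (k : ℝ) + 7) * (d : ℝ) * ((d : ℝ) + 1) - 1) / 2⌉₊ := by
  by_contra! hlt
  have h₁ := Nat.ceil_le.1 (Nat.le_sub_one_of_lt hlt)
  have hpos : 1 ≤ 7 * (k + 1) * d := Nat.mul_pos (by omega) hd
  have hd' : (1 : ℝ) ≤ d := by exact_mod_cast hd
  have h₂ : 7 * ((k : ℝ) + 1) * d * 2 ≤ (9 * (k : ℝ) + 7) * d * (d + 1) :=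
    mul_le_mul (mul_le_mul_of_nonneg_right (by linarith [(k.cast_nonneg : (0 : ℝ) ≤ k)])
      (by positivity)) (by linarith) (by norm_num) (by positivity)
  push_cast [Nat.cast_sub hpos] at h₁
  linarith

end SimpleGraph

theorem mainTheorem2 :
    (∀ (k d t : ℕ), 1 ≤ d → 2 ≤ t →
      ∀ (V : Type*) [Fintype V] (G : SimpleGraph V) [DecidableRel G.Adj] (w : V → ℝ),
        (∀ v, 0 ≤ w v) → G.treewidth ≤ (k : ℤ) → G.maxDegree ≤ d →
        G.IsTrimmable w (t : ℝ)
          (⌈((9 * (k : ℝ) + 7) * (d : ℝ) * ((d : ℝ) + 1) - 1) / 2⌉₊ ^ (2 * t))) ∧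
    (∀ (ι : Type*) (V : ι → Type*) [∀ i, Fintype (V i)] (G : ∀ i, SimpleGraph (V i))
        [∀ i, DecidableRel (G i).Adj],
      (∃ d : ℕ, ∀ i, (G i).maxDegree ≤ d) → (∃ k : ℕ, ∀ i, (G i).treewidth ≤ (k : ℤ)) →
      SimpleGraph.IsTrimmableFamily G) := by
  refine ⟨fun k d t hd ht V _ G _ w hw hk hdeg => ?_, ?_⟩
  · exact (SimpleGraph.isTrimmable_of_treewidth_le hd (by omega) w hk hdeg).mono hw
      (by positivity) le_rfl (Nat.pow_le_pow_left (SimpleGraph.seven_mul_le_ceil hd) _)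
  · rintro ι V _ G _ ⟨d, hd⟩ ⟨k, hk⟩ t ht
    refine ⟨(7 * (k + 1) * (d + 1)) ^ (2 * ⌈t⌉₊), fun i w hw => ?_⟩
    exact (SimpleGraph.isTrimmable_of_treewidth_le (Nat.succ_pos d) (Nat.ceil_pos.2 ht) w (hk i)
      ((hd i).trans (Nat.le_succ d))).mono hw ht (Nat.le_ceil t) le_rfl
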